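/- Let $(P,d,\mu)$ be a metric space with a $\sigma$-finite, non-atomic, Borel regular measure $\mu$ such that every ball has finite positive measure ($\mu$ is not assumed to be doubling). "Measurable" means $\mu$-measurable, functions are defined everywhere with values in $[-\infty,\infty]$, and for such a function $f$ and $\sigma\ge 0$ put $\{|f|>\sigma\}=\{x\in P: |f(x)|>\sigma\}$. Let $X$ be a quasi-Banach function lattice over $(P,\mu)$ with continuous quasi-norm, i.e. $X=\{f \text{ measurable}: \|f\|_X<\infty\}$, where $\|\cdot\|_X$ maps measurable functions to $[0,\infty]$ and, for some constant $c\ge 1$: $\|f\|_X=0$ iff $f=0$ a.e.; $\|af\|_X=|a|\,\|f\|_X$ for $a\in\mathbb R$; $\|f+g\|_X\le c(\|f\|_X+\|g\|_X)$; $|f|\le|g|$ a.e. implies $\|f\|_X\le\|g\|_X$; $\|\sum_{n\ge1} f_n\|_X\le\sum_{n\ge1}c^n\|f_n\|_X$ whenever $f_n\ge0$; and $\|f_n-f\|_X\to0$ implies $\|f_n\|_X\to\|f\|_X$. Assume that the quasi-norm is absolutely continuous: for every $f\in X$, $\|f\chi_{E_n}\|_X\to0$ whenever $E_1\supset E_2\supset\cdots$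 are measurable sets with $\mu(\bigcap_n E_n)=0$. A Borel function $g:P\to[0,\infty]$ is an upper gradient of $u:P\to[-\infty,\infty]$ if $|u(\gamma(0))-u(\gamma(l))|\le\int_0^{l} g(\gamma(t))\,dt$ for every non-constant rectifiable curve $\gamma:[0,l]\to P$ parametrized by arc length, where $|(\pm\infty)-(\pm\infty)|=\infty$. For measurable $u$ put $\|u\|_{N^1X}=\|u\|_X+\inf_g\|g\|_X$, the infimum being over all upper gradients $g$ of $u$, and let $N^1X=\{u \text{ measurable}:\|u\|_{N^1X}<\infty\}$. A measurable $h:P\to[0,\infty]$ is a Hajłasz gradient of $u$ if there is a set $E$ with $\mu(E)=0$ such that $|u(x)-u(y)|\le d(x,y)(h(x)+h(y))$ for all $x,y\in P\setminus E$. For $q>0$, $L^q_{\mathrm{fm}}$ is the set of measurable $f$ with $\int_E|f|^q\,d\mu<\infty$ for every measurable $E$ with $\mu(E)<\infty$. **Theorem.** Suppose that $u\in N^1X$ has a Hajłasz gradient $h$ such that $\|\sigma\chi_{\{h>\sigma\}}\|_X\to0$ as $\sigma\to\infty$, or such that $h\in X$. Then for every $\varepsilon>0$ there are a Lipschitz function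 $u_\varepsilon:P\to\mathbb R$ with $u_\varepsilon\in N^1X$ and a measurable set $E_\varepsilon\subset P$ such that $$\|u-u_\varepsilon\|_{N^1X}<\varepsilon,\qquad u=u_\varepsilon\ \text{ on } P\setminus E_\varepsilon,\qquad\text{and}\qquad \mu\Bigl(\bigcap_{\varepsilon>0}E_\varepsilon\Bigr)=0.$$ Moreover, these can be chosen so that $\mu(E_\varepsilon)<\varepsilon$ for every $\varepsilon>0$, provided that one of the following holds: (a) $\{h>\sigma\}$ and $\{|u|>\sigma\}$ have finite measure for some $\sigma>0$; (b) $u,h\in L^q_{\mathrm{fm}}$ for some $q>0$; (c) $X\subset L^q_{\mathrm{fm}}$ for some $q>0$. -/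

import Mathlib

open MeasureTheory Filter Topology Set
open scoped ENNReal NNReal

/-- A quasi-Banach function lattice over `(P, μ)` with continuous quasi-norm. `nrm u` is the
quasi-norm of `u`; it matters only for `μ`-measurable (that is, a.e.-measurable with respect to
the Borel `σ`-algebra) extended real-valued functions defined everywhere. The space itself is the
set of `u` with `nrm u < ∞`, see `QBFL.Mem`. -/
structure QBFL {P : Type*} [MeasurableSpace P] (μ : Measure P) where
  /-- the quasi-norm -/
  nrm : (P → EReal) → ℝ≥0∞
  /-- the modulus of concavity -/
  conc : ℝ≥0
  one_le_conc : 1 ≤ conc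
  nrm_eq_zero : ∀ u : P → EReal, AEMeasurable u μ → (nrm u = 0 ↔ u =ᵐ[μ] 0)
  nrm_smul : ∀ (a : ℝ) (u : P → EReal), AEMeasurable u μ →
    nrm (fun x => (a : EReal) * u x) = ENNReal.ofReal |a| * nrm u
  nrm_add_le : ∀ u v : P → EReal, AEMeasurable u μ → AEMeasurable v μ →
    nrm (fun x => u x + v x) ≤ conc * (nrm u + nrm v)
  /-- the lattice property -/
  nrm_mono : ∀ u v : P → EReal, AEMeasurable u μ → AEMeasurable v μ →
    (∀ᵐ x ∂μ, (u x).abs ≤ (v x).abs) → nrm u ≤ nrm v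
  /-- the Riesz--Fischer property; the sequence is indexed from `0` -/
  riesz_fischer : ∀ u : ℕ → P → ℝ≥0∞, (∀ n, AEMeasurable (u n) μ) →
    nrm (fun x => ((∑' n, u n x : ℝ≥0∞) : EReal)) ≤
      ∑' n, (conc : ℝ≥0∞) ^ (n + 1) * nrm (fun x => (u n x : EReal))
  /-- continuity of the quasi-norm -/
  nrm_continuous : ∀ (u : ℕ → P → EReal) (v : P → EReal),
    (∀ n, AEMeasurable (u n) μ) → AEMeasurable v μ →
    Tendsto (fun n => nrm (fun x => u n x - v x)) atTop (𝓝 0) →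
    Tendsto (fun n => nrm (u n)) atTop (𝓝 (nrm v))

namespace QBFL

variable {P : Type*} [MeasurableSpace P] {μ : Measure P}

/-- `u ∈ X`. -/
def Mem (X : QBFL μ) (u : P → EReal) : Prop :=
  AEMeasurable u μ ∧ X.nrm u < ⊤

/-- The quasi-norm of `X` is absolutely continuous. -/
def IsAbsCont (X : QBFL μ) : Prop :=
  ∀ u : P → EReal, X.Mem u → ∀ E : ℕ → Set P, Antitone E →
    (∀ n, NullMeasurableSet (E n) μ) → μ (⋂ n, E n) = 0 →
    Tendsto (fun n => X.nrm ((E n).indicator u)) atTop (𝓝 0)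

end QBFL

/-- The Borel function `g` is an upper gradient of `u`. The curves are the non-constant
rectifiable ones, `γ : [0, l] → P` with `l > 0` parametrized by arc length. In `EReal`,
`(a - b).abs = ⊤` as soon as `a` or `b` is infinite, including `a = b = ±∞`. -/
def IsUpperGradient {P : Type*} [MetricSpace P] [MeasurableSpace P]
    (g : P → ℝ≥0∞) (u : P → EReal) : Prop :=
  Measurable g ∧ ∀ (l : ℝ) (γ : ℝ → P), 0 < l → HasUnitSpeedOn γ (Icc 0 l) →
    (u (γ 0) - u (γ l)).abs ≤ ∫⁻ t in Icc 0 l, g (γ t)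

/-- The Newtonian quasi-norm: the quasi-norm of `u` in `X` plus the infimum of those of its upper
gradients. -/
noncomputable def newtonNorm {P : Type*} [MetricSpace P] [MeasurableSpace P] {μ : Measure P}
    (X : QBFL μ) (u : P → EReal) : ℝ≥0∞ :=
  X.nrm u + ⨅ (g : P → ℝ≥0∞) (_ : IsUpperGradient g u), X.nrm (fun x => (g x : EReal))

/-- `u` belongs to the Newtonian space based on `X`. -/
def MemNewton {P : Type*} [MetricSpace P] [MeasurableSpace P] {μ : Measure P}
    (X : QBFL μ) (u : P → EReal) : Prop :=
  AEMeasurable u μ ∧ newtonNorm X u < ⊤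

/-- `h` is a Hajłasz gradient of `u`. -/
def IsHajlaszGradient {P : Type*} [MetricSpace P] [MeasurableSpace P] (μ : Measure P)
    (h : P → ℝ≥0∞) (u : P → EReal) : Prop :=
  AEMeasurable h μ ∧ ∃ E : Set P, μ E = 0 ∧ ∀ x ∉ E, ∀ y ∉ E,
    (u x - u y).abs ≤ edist x y * (h x + h y)

/-- The superlevel set `{|u| > σ}`. -/
def supLevel {P : Type*} (u : P → EReal) (σ : ℝ≥0) : Set P :=
  {x | (σ : ℝ≥0∞) < (u x).abs}

/-- `f` belongs to `L^q` on every measurable set of finite measure. -/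
def MemLqFin {P : Type*} [MeasurableSpace P] (μ : Measure P) (q : ℝ) (f : P → EReal) : Prop :=
  AEMeasurable f μ ∧ ∀ E : Set P, NullMeasurableSet E μ → μ E < ⊤ →
    ∫⁻ x in E, (f x).abs ^ q ∂μ < ⊤

/-- The measure `μ` is non-atomic: every measurable set of positive measure has a measurable
subset of strictly smaller positive measure. -/
def IsNonatomic {P : Type*} [MeasurableSpace P] (μ : Measure P) : Prop :=
  ∀ A : Set P, MeasurableSet A → 0 < μ A → ∃ B ⊆ A, MeasurableSet B ∧ 0 < μ B ∧ μ B < μ A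

/-!
Let `k = max h |u|`. The Hajłasz inequality makes `u` Lipschitz with constant `2n` and bounded by
`n` on `{k ≤ n}`, so the truncated McShane extension `v` of `u` from this set is `2n`-Lipschitz and
bounded by `n`. Now `|u - v| ≤ (|u| + n) χ_{k > n}`, and if `g` is an upper gradient of `u`, then
`(g + 2n) χ_{k > n} + δ g` is one of `u - v` for every `δ > 0`: along a curve on which `g` is
integrable, `u - v` is continuous and vanishes off `{k > n}`, so only the part of the curve inside
`{k > n}` contributes. Since `k < ∞` almost everywhere, absolute continuity makes the terms with
`|u|` and `g` small, and `‖n χ_{k > n}‖_X → 0` is the hypothesis on `h` combined with `u ∈ X`.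

The sets `{k > n}` decrease to a null set, so their measures tend to `0` as soon as one of them is
finite. If a function belongs to `L^q` on sets of finite measure, one of its superlevel sets has
finite measure: otherwise non-atomicity provides pieces of measure about `2⁻ⁿ`
inside `{|f|^q > 4ⁿ}`, and `|f|^q` is not integrable over their union, which has finite measure.
-/

section ExtendedReals

theorem measurable_ereal_abs : Measurable EReal.abs :=
  EReal.measurable_of_measurable_real (measurable_id.abs.ennreal_ofReal)

theorem aemeasurable_ereal_sub_coe {α : Type*} [MeasurableSpace α] {μ : Measure α} {u : α → EReal}
    {v : α → ℝ} (hu : AEMeasurable u μ) (hv : AEMeasurable v μ) :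
    AEMeasurable (fun x => u x - v x) μ := by
  simpa only [sub_eq_add_neg] using! hu.add hv.coe_real_ereal.neg

@[simp]
theorem ereal_abs_coe_ennreal (a : ℝ≥0∞) : (a : EReal).abs = a := by
  induction a with
  | top => rfl
  | coe r =>
    change ((r : ℝ) : EReal).abs = r
    rw [EReal.abs_def, abs_of_nonneg r.coe_nonneg, ENNReal.ofReal_coe_nnreal]

theorem ereal_abs_coe_sub_coe (a b : ℝ) : ((a : EReal) - b).abs = edist a b := by
  rw [← EReal.coe_sub, EReal.abs_def, edist_dist, Real.dist_eq]

theorem ereal_abs_coe_eq_edist_zero (a : ℝ) : (a : EReal).abs = edist a 0 := by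
  rw [EReal.abs_def, edist_dist, Real.dist_eq, sub_zero]

theorem ereal_abs_sub_coe_le (a : EReal) (r : ℝ) : (a - r).abs ≤ a.abs + (r : EReal).abs := by
  induction a with
  | bot => simp
  | top => simp
  | coe s =>
    rw [ereal_abs_coe_sub_coe, ereal_abs_coe_eq_edist_zero, ereal_abs_coe_eq_edist_zero]
    exact edist_triangle_right s r 0

theorem ereal_abs_coe_le_abs_add_abs_sub (a : EReal) (r : ℝ) :
    (r : EReal).abs ≤ a.abs + (a - r).abs := by
  induction a with
  | bot => simp
  | top => simp
  | coe s =>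
    rw [ereal_abs_coe_sub_coe, ereal_abs_coe_eq_edist_zero, ereal_abs_coe_eq_edist_zero, add_comm]
    exact edist_triangle_left r 0 s

theorem ereal_coe_toReal_of_abs_lt_top {a : EReal} (h : a.abs < ⊤) : (a.toReal : EReal) = a := by
  refine EReal.coe_toReal ?_ ?_ <;> rintro rfl <;> simp at h

theorem ereal_coe_toReal_of_abs_sub_lt_top {a b : EReal} (h : (a - b).abs < ⊤) :
    (a.toReal : EReal) = a ∧ (b.toReal : EReal) = b := by
  induction a <;> induction b <;> simp_all

end ExtendedReals

section Curves

variable {E : Type*} [PseudoEMetricSpace E] {γ : ℝ → E} {s : Set ℝ}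

theorem lipschitzOnWith_one_of_hasUnitSpeedOn (hγ : HasUnitSpeedOn γ s) :
    LipschitzOnWith 1 γ s := by
  have edist_le_of_le : ∀ x ∈ s, ∀ y ∈ s, x ≤ y → edist (γ x) (γ y) ≤ edist x y := by
    intro x hx y hy hxy
    calc edist (γ x) (γ y) ≤ eVariationOn γ (s ∩ Icc x y) :=
          eVariationOn.edist_le γ ⟨hx, left_mem_Icc.2 hxy⟩ ⟨hy, right_mem_Icc.2 hxy⟩
      _ = ENNReal.ofReal (y - x) := by rw [hγ hx hy, NNReal.coe_one, one_mul]
      _ = edist x y := by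
          rw [edist_comm, edist_dist, Real.dist_eq, abs_of_nonneg (sub_nonneg.2 hxy)]
  intro x hx y hy
  rw [ENNReal.coe_one, one_mul]
  rcases le_total x y with hxy | hyx
  · exact edist_le_of_le x hx y hy hxy
  · rw [edist_comm, edist_comm x]
    exact edist_le_of_le y hy x hx hyx

theorem edist_comp_le_lintegral_of_hasUnitSpeedOn {F : Type*} [PseudoEMetricSpace F] {v : E → F}
    {K : ℝ≥0} (hv : LipschitzWith K v) (hγ : HasUnitSpeedOn γ s) {a b : ℝ} (ha : a ∈ s)
    (hb : b ∈ s) (hab : a ≤ b) :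
    edist (v (γ a)) (v (γ b)) ≤ ∫⁻ _ in Icc a b, (K : ℝ≥0∞) := by
  have hlip := hv.comp_lipschitzOnWith (lipschitzOnWith_one_of_hasUnitSpeedOn hγ) ha hb
  rwa [mul_one, edist_comm a, edist_dist b, Real.dist_eq, abs_of_nonneg (sub_nonneg.2 hab),
    ← Real.volume_Icc, ← setLIntegral_const] at hlip

theorem hasUnitSpeedOn_mono (hγ : HasUnitSpeedOn γ s) {t : Set ℝ} [ht : t.OrdConnected]
    (hts : t ⊆ s) : HasUnitSpeedOn γ t := by
  intro x hx y hy
  have hxyt : Icc x y ⊆ t := ht.out hx hy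
  rw [← hγ (hts hx) (hts hy), inter_eq_right.2 hxyt, inter_eq_right.2 (hxyt.trans hts)]

theorem hasUnitSpeedOn_comp_add_right (hγ : HasUnitSpeedOn γ s) (c : ℝ) :
    HasUnitSpeedOn (fun τ => γ (τ + c)) ((· + c) ⁻¹' s) := by
  intro x hx y hy
  have hmono : MonotoneOn (· + c) ((· + c) ⁻¹' s) := (add_left_mono (a := c)).monotoneOn _
  have himage : (· + c) '' ((· + c) ⁻¹' s) = s :=
    image_preimage_eq s (Equiv.addRight c).surjective
  have hvar := eVariationOn.comp_inter_Icc_eq_of_monotoneOn γ (· + c) hmono hx hy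
  rw [himage, hγ hx hy, add_sub_add_right_eq_sub] at hvar
  exact hvar

end Curves

section IntegralOscillation

variable {E : Type*} {w : ℝ → E} {F : ℝ → ℝ≥0∞} {a b : ℝ}

theorem continuousOn_of_edist_le_setLIntegral [PseudoEMetricSpace E]
    (hF : ∫⁻ t in Icc a b, F t ≠ ⊤)
    (hw : ∀ s t, a ≤ s → s ≤ t → t ≤ b → edist (w s) (w t) ≤ ∫⁻ τ in Icc s t, F τ) :
    ContinuousOn w (Icc a b) := by
  intro t₀ ht₀
  have hosc : ∀ t ∈ Icc a b,
      edist (w t) (w t₀) ≤ ∫⁻ τ in uIcc t₀ t, F τ ∂volume.restrict (Icc a b) := by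
    intro t ht
    rw [Measure.restrict_restrict measurableSet_uIcc,
      inter_eq_self_of_subset_left (uIcc_subset_Icc ht₀ ht)]
    rcases le_total t t₀ with h | h
    · rw [uIcc_of_ge h]
      exact hw t t₀ ht.1 h ht₀.2
    · rw [uIcc_of_le h, edist_comm]
      exact hw t₀ t ht₀.1 h ht.2
  have hvol : Tendsto (fun t => volume.restrict (Icc a b) (uIcc t₀ t)) (𝓝 t₀) (𝓝 0) := by
    have hlen : Tendsto (fun t => volume (uIcc t₀ t)) (𝓝 t₀) (𝓝 0) := by
      have hcont : Continuous fun t => ENNReal.ofReal |t - t₀| :=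
        ENNReal.continuous_ofReal.comp (by fun_prop)
      simpa using hcont.tendsto t₀
    exact tendsto_of_tendsto_of_tendsto_of_le_of_le tendsto_const_nhds hlen (fun _ => zero_le)
      fun t => Measure.restrict_apply_le _ _
  refine tendsto_iff_edist_tendsto_0.2 ?_
  exact tendsto_of_tendsto_of_tendsto_of_le_of_le' tendsto_const_nhds
    (tendsto_setLIntegral_zero hF (hvol.mono_left nhdsWithin_le_nhds))
    (Eventually.of_forall fun _ => zero_le) (eventually_mem_nhdsWithin.mono hosc)

theorem edist_endpoints_le_lintegral_indicator [EMetricSpace E] (hab : a ≤ b)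
    (hF : ∫⁻ t in Icc a b, F t ≠ ⊤)
    (hw : ∀ s t, a ≤ s → s ≤ t → t ≤ b → edist (w s) (w t) ≤ ∫⁻ τ in Icc s t, F τ)
    {B : Set ℝ} {c : E} (hB : ∀ t ∈ Icc a b, t ∉ B → w t = c) :
    edist (w a) (w b) ≤ ∫⁻ t in Icc a b, B.indicator F t := by
  by_cases hall : ∀ t ∈ Icc a b, t ∈ B
  · refine (hw a b le_rfl hab le_rfl).trans_eq ?_
    exact setLIntegral_congr_fun measurableSet_Icc fun t ht => (indicator_of_mem (hall t ht) F).symm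
  push Not at hall
  obtain ⟨t₀, ht₀, ht₀B⟩ := hall
  set Z : Set ℝ := Icc a b ∩ w ⁻¹' {c}
  have hZ : IsCompact Z := isCompact_Icc.of_isClosed_subset
    ((continuousOn_of_edist_le_setLIntegral hF hw).preimage_isClosed_of_isClosed isClosed_Icc
      isClosed_singleton) inter_subset_left
  have hZne : Z.Nonempty := ⟨t₀, ht₀, hB t₀ ht₀ ht₀B⟩
  obtain ⟨p, ⟨hp, hwp⟩, hpmin⟩ := hZ.exists_isLeast hZne
  obtain ⟨r, ⟨hr, hwr⟩, hrmax⟩ := hZ.exists_isGreatest hZne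
  have hpr : p ≤ r := hpmin ⟨hr, hwr⟩
  have mem_B : ∀ t ∈ Icc a b, t ∉ Z → t ∈ B := fun t ht htZ =>
    not_not.1 fun htB => htZ ⟨ht, hB t ht htB⟩
  have hleft : ∫⁻ τ in Icc a p, F τ = ∫⁻ τ in Ico a p, B.indicator F τ := by
    rw [setLIntegral_congr Ico_ae_eq_Icc.symm]
    refine setLIntegral_congr_fun measurableSet_Ico fun t ht => (indicator_of_mem ?_ F).symm
    exact mem_B t ⟨ht.1, ht.2.le.trans hp.2⟩ fun htZ => ht.2.not_ge (hpmin htZ)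
  have hright : ∫⁻ τ in Icc r b, F τ = ∫⁻ τ in Ioc r b, B.indicator F τ := by
    rw [setLIntegral_congr Ioc_ae_eq_Icc.symm]
    refine setLIntegral_congr_fun measurableSet_Ioc fun t ht => (indicator_of_mem ?_ F).symm
    exact mem_B t ⟨hr.1.trans ht.1.le, ht.2⟩ fun htZ => ht.1.not_ge (hrmax htZ)
  have hdisj : Disjoint (Ico a p) (Ioc r b) :=
    disjoint_left.2 fun t ht ht' => (ht.2.trans_le hpr).not_gt ht'.1
  calc edist (w a) (w b) ≤ edist (w a) (w p) + edist (w r) (w b) := by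
        rw [hwp, hwr]; exact edist_triangle _ _ _
    _ ≤ (∫⁻ τ in Icc a p, F τ) + ∫⁻ τ in Icc r b, F τ :=
        add_le_add (hw a p le_rfl hp.1 hp.2) (hw r b hr.1 hr.2 le_rfl)
    _ = ∫⁻ τ in Ico a p ∪ Ioc r b, B.indicator F τ := by
        rw [hleft, hright, lintegral_union measurableSet_Ioc hdisj]
    _ ≤ ∫⁻ t in Icc a b, B.indicator F t := lintegral_mono_set <|
        union_subset (Ico_subset_Icc_self.trans (Icc_subset_Icc_right hp.2))
          (Ioc_subset_Icc_self.trans (Icc_subset_Icc_left hr.1))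

end IntegralOscillation

namespace IsUpperGradient

variable {P : Type*} [MetricSpace P] [MeasurableSpace P] {g : P → ℝ≥0∞} {u : P → EReal}

theorem abs_sub_le (hg : IsUpperGradient g u) {γ : ℝ → P} {s t : ℝ} (hst : s < t)
    (hγ : HasUnitSpeedOn γ (Icc s t)) :
    (u (γ s) - u (γ t)).abs ≤ ∫⁻ τ in Icc s t, g (γ τ) := by
  have hshift : HasUnitSpeedOn (fun τ => γ (τ + s)) (Icc 0 (t - s)) := by
    simpa using hasUnitSpeedOn_comp_add_right hγ s
  have hcurve := hg.2 (t - s) _ (sub_pos.2 hst) hshift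
  have htranslate := (measurePreserving_add_right volume s).setLIntegral_comp_preimage_emb
    (measurableEmbedding_addRight s) (fun τ => g (γ τ)) (Icc s t)
  rw [preimage_add_const_Icc, sub_self] at htranslate
  simpa only [zero_add, sub_add_cancel, htranslate] using hcurve

theorem exists_real_along_curve (hg : IsUpperGradient g u) {γ : ℝ → P} {l : ℝ} (hl : 0 < l)
    (hγ : HasUnitSpeedOn γ (Icc 0 l)) (hfin : ∫⁻ t in Icc 0 l, g (γ t) ≠ ⊤) :
    ∃ U : ℝ → ℝ, (∀ t ∈ Icc 0 l, u (γ t) = U t) ∧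
      ∀ s t, 0 ≤ s → s ≤ t → t ≤ l → edist (U s) (U t) ≤ ∫⁻ τ in Icc s t, g (γ τ) := by
  have hosc : ∀ s t, 0 ≤ s → s < t → t ≤ l →
      (u (γ s) - u (γ t)).abs ≤ ∫⁻ τ in Icc s t, g (γ τ) := fun s t hs hst ht =>
    hg.abs_sub_le hst (hasUnitSpeedOn_mono hγ (Icc_subset_Icc hs ht))
  have hreal : ∀ t ∈ Icc 0 l, ((u (γ t)).toReal : EReal) = u (γ t) := by
    have hfinite : ∀ t, 0 < t → t ≤ l → (u (γ 0) - u (γ t)).abs < ⊤ := fun t h0 ht =>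
      ((hosc 0 t le_rfl h0 ht).trans (lintegral_mono_set (Icc_subset_Icc_right ht))).trans_lt
        hfin.lt_top
    rintro t ⟨h0, ht⟩
    rcases h0.eq_or_lt with rfl | h0
    · exact (ereal_coe_toReal_of_abs_sub_lt_top (hfinite l hl le_rfl)).1
    · exact (ereal_coe_toReal_of_abs_sub_lt_top (hfinite t h0 ht)).2
  refine ⟨fun t => (u (γ t)).toReal, fun t ht => (hreal t ht).symm, fun s t hs hst ht => ?_⟩
  rcases hst.eq_or_lt with rfl | hlt
  · simp
  · rw [← ereal_abs_coe_sub_coe, hreal s ⟨hs, hst.trans ht⟩, hreal t ⟨hs.trans hst, ht⟩]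
    exact hosc s t hs hlt ht

/-- The summand `δ * g` is there only for the curves along which `g` is not integrable: on these
`u` need not be continuous, and the values of `g + K` on `A` alone need not detect it. -/
theorem sub_lipschitz (hg : IsUpperGradient g u) {v : P → ℝ} {K : ℝ≥0} (hv : LipschitzWith K v)
    {A : Set P} (hA : MeasurableSet A) (huv : ∀ x ∉ A, u x = v x) {δ : ℝ≥0} (hδ : δ ≠ 0) :
    IsUpperGradient (fun x => A.indicator (fun y => g y + K) x + δ * g x)
      (fun x => u x - v x) := by
  refine ⟨((hg.1.add_const _).indicator hA).add (hg.1.const_mul _), fun l γ hl hγ => ?_⟩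
  by_cases hfin : ∫⁻ t in Icc 0 l, g (γ t) = ⊤
  · calc (u (γ 0) - v (γ 0) - (u (γ l) - v (γ l))).abs ≤ δ * ∫⁻ t in Icc 0 l, g (γ t) := by
          rw [hfin, ENNReal.mul_top (ENNReal.coe_ne_zero.2 hδ)]; exact le_top
      _ ≤ ∫⁻ t in Icc 0 l, δ * g (γ t) := lintegral_const_mul_le _ _
      _ ≤ _ := lintegral_mono fun t => le_add_self
  obtain ⟨U, hU, hUosc⟩ := hg.exists_real_along_curve hl hγ hfin
  have hosc : ∀ s t, 0 ≤ s → s ≤ t → t ≤ l →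
      edist (U s - v (γ s)) (U t - v (γ t)) ≤ ∫⁻ τ in Icc s t, (g (γ τ) + K) := by
    intro s t hs hst ht
    have hvosc := edist_comp_le_lintegral_of_hasUnitSpeedOn hv hγ ⟨hs, hst.trans ht⟩
      ⟨hs.trans hst, ht⟩ hst
    exact (edist_vsub_vsub_le _ _ _ _).trans <|
      (add_le_add (hUosc s t hs hst ht) hvosc).trans (le_lintegral_add _ _)
  have hint : ∫⁻ t in Icc 0 l, (g (γ t) + K) ≠ ⊤ := by
    rw [lintegral_add_right _ measurable_const, setLIntegral_const, Real.volume_Icc]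
    exact ENNReal.add_ne_top.2 ⟨hfin, ENNReal.mul_ne_top ENNReal.coe_ne_top ENNReal.ofReal_ne_top⟩
  have hvanish : ∀ t ∈ Icc 0 l, t ∉ γ ⁻¹' A → U t - v (γ t) = 0 := fun t ht htA =>
    sub_eq_zero.2 (EReal.coe_eq_coe_iff.1 ((hU t ht).symm.trans (huv _ htA)))
  have hmain := edist_endpoints_le_lintegral_indicator hl.le hint hosc hvanish
  beta_reduce
  rw [hU 0 (left_mem_Icc.2 hl.le), hU l (right_mem_Icc.2 hl.le), ← EReal.coe_sub, ← EReal.coe_sub,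
    ereal_abs_coe_sub_coe]
  exact hmain.trans (lintegral_mono fun t => le_self_add)

theorem of_sub (hg : IsUpperGradient g u) {G : P → ℝ≥0∞} {v : P → ℝ}
    (hG : IsUpperGradient G (fun x => u x - v x)) :
    IsUpperGradient (fun x => g x + G x) (fun x => (v x : EReal)) := by
  refine ⟨hg.1.add hG.1, fun l γ hl hγ => ?_⟩
  by_cases hfin : ∫⁻ t in Icc 0 l, g (γ t) = ⊤
  · refine le_top.trans ?_
    rw [← hfin]
    exact lintegral_mono fun t => le_self_add
  obtain ⟨U, hU, hUosc⟩ := hg.exists_real_along_curve hl hγ hfin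
  have hUv := hG.2 l γ hl hγ
  beta_reduce at hUv ⊢
  rw [hU 0 (left_mem_Icc.2 hl.le), hU l (right_mem_Icc.2 hl.le), ← EReal.coe_sub, ← EReal.coe_sub,
    ereal_abs_coe_sub_coe] at hUv
  rw [ereal_abs_coe_sub_coe]
  calc edist (v (γ 0)) (v (γ l))
      = edist (U 0 - (U 0 - v (γ 0))) (U l - (U l - v (γ l))) := by simp only [sub_sub_cancel]
    _ ≤ edist (U 0) (U l) + edist (U 0 - v (γ 0)) (U l - v (γ l)) := edist_vsub_vsub_le _ _ _ _
    _ ≤ (∫⁻ t in Icc 0 l, g (γ t)) + ∫⁻ t in Icc 0 l, G (γ t) :=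
        add_le_add (hUosc 0 l le_rfl hl.le le_rfl) hUv
    _ ≤ ∫⁻ t in Icc 0 l, (g (γ t) + G (γ t)) := le_lintegral_add _ _

end IsUpperGradient

section SuperlevelSets

variable {P : Type*}

theorem antitone_setOf_natCast_lt (f : P → ℝ≥0∞) :
    Antitone fun n : ℕ => {x | (n : ℝ≥0∞) < f x} :=
  fun _ _ hmn x (hx : _ < f x) => (Nat.cast_le.2 hmn).trans_lt hx

theorem iInter_setOf_natCast_lt (f : P → ℝ≥0∞) :
    ⋂ n : ℕ, {x | (n : ℝ≥0∞) < f x} = f ⁻¹' {⊤} := by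
  ext x
  refine ⟨fun hx => by_contra fun htop => ?_, fun hx => mem_iInter.2 fun n => ?_⟩
  · obtain ⟨n, hn⟩ := ENNReal.exists_nat_gt htop
    exact lt_asymm hn (mem_iInter.1 hx n)
  · exact (ENNReal.natCast_lt_top n).trans_eq (Eq.symm hx)

theorem measure_iInter_setOf_natCast_lt [MeasurableSpace P] {μ : Measure P} {f : P → ℝ≥0∞}
    (hf : ∀ᵐ x ∂μ, f x < ⊤) : μ (⋂ n : ℕ, {x | (n : ℝ≥0∞) < f x}) = 0 := by
  rw [iInter_setOf_natCast_lt]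
  simpa only [ae_iff, not_lt_top_iff] using! hf

theorem supLevel_coe_ennreal (f : P → ℝ≥0∞) (σ : ℝ≥0) :
    supLevel (fun x => (f x : EReal)) σ = {x | (σ : ℝ≥0∞) < f x} := by
  simp only [supLevel, ereal_abs_coe_ennreal]

end SuperlevelSets

namespace QBFL

variable {P : Type*} [MeasurableSpace P] {μ : Measure P} {X : QBFL μ} {f g : P → ℝ≥0∞}

/-- The quasi-norm of `X` on nonnegative functions, where no passage through `EReal` is needed. -/
noncomputable def enrm (X : QBFL μ) (f : P → ℝ≥0∞) : ℝ≥0∞ :=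
  X.nrm fun x => (f x : EReal)

theorem enrm_mono (hf : AEMeasurable f μ) (hg : AEMeasurable g μ) (h : ∀ᵐ x ∂μ, f x ≤ g x) :
    X.enrm f ≤ X.enrm g :=
  X.nrm_mono _ _ hf.coe_ereal_ennreal hg.coe_ereal_ennreal
    (by simpa only [ereal_abs_coe_ennreal] using h)

theorem nrm_eq_enrm_abs {u : P → EReal} (hu : AEMeasurable u μ) :
    X.nrm u = X.enrm fun x => (u x).abs := by
  have habs := (measurable_ereal_abs.comp_aemeasurable hu).coe_ereal_ennreal
  exact le_antisymm (X.nrm_mono _ _ hu habs (by simp)) (X.nrm_mono _ _ habs hu (by simp))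

theorem enrm_add_le (hf : AEMeasurable f μ) (hg : AEMeasurable g μ) :
    X.enrm (fun x => f x + g x) ≤ X.conc * (X.enrm f + X.enrm g) := by
  simpa only [enrm, EReal.coe_ennreal_add] using
    X.nrm_add_le _ _ hf.coe_ereal_ennreal hg.coe_ereal_ennreal

theorem enrm_add_lt_top (hf : AEMeasurable f μ) (hg : AEMeasurable g μ) (hf' : X.enrm f < ⊤)
    (hg' : X.enrm g < ⊤) : X.enrm (fun x => f x + g x) < ⊤ :=
  (enrm_add_le hf hg).trans_lt
    (ENNReal.mul_lt_top ENNReal.coe_lt_top (ENNReal.add_lt_top.2 ⟨hf', hg'⟩))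

theorem enrm_const_mul (a : ℝ≥0) (hf : AEMeasurable f μ) :
    X.enrm (fun x => a * f x) = a * X.enrm f := by
  have hsmul := X.nrm_smul a _ hf.coe_ereal_ennreal
  rw [abs_of_nonneg a.coe_nonneg, ENNReal.ofReal_coe_nnreal] at hsmul
  simpa only [enrm, EReal.coe_ennreal_mul, EReal.coe_nnreal_eq_coe_real] using hsmul

theorem enrm_indicator_one_eq_zero_iff {S : Set P} (hS : NullMeasurableSet S μ) :
    X.enrm (S.indicator 1) = 0 ↔ μ S = 0 := by
  have hmeas : AEMeasurable (S.indicator (1 : P → ℝ≥0∞)) μ := aemeasurable_const.indicator₀ hS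
  calc X.enrm (S.indicator 1) = 0 ↔ S.indicator (1 : P → ℝ≥0∞) =ᵐ[μ] 0 := by
        rw [enrm, X.nrm_eq_zero _ hmeas.coe_ereal_ennreal]
        simp only [EventuallyEq, Pi.zero_apply, EReal.coe_ennreal_eq_zero]
    _ ↔ μ S = 0 := by rw [indicator_ae_eq_zero, Function.support_one, inter_univ]

section Limits

variable {ι : Type*} {l : Filter ι} {F G : ι → P → ℝ≥0∞}

theorem tendsto_enrm_zero_of_le (hF : ∀ i, AEMeasurable (F i) μ) (hG : ∀ i, AEMeasurable (G i) μ)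
    (hG₀ : Tendsto (fun i => X.enrm (G i)) l (𝓝 0)) (hFG : ∀ i, ∀ᵐ x ∂μ, F i x ≤ G i x) :
    Tendsto (fun i => X.enrm (F i)) l (𝓝 0) :=
  tendsto_of_tendsto_of_tendsto_of_le_of_le tendsto_const_nhds hG₀ (fun _ => zero_le)
    fun i => enrm_mono (hF i) (hG i) (hFG i)

theorem tendsto_enrm_add (hF : ∀ i, AEMeasurable (F i) μ) (hG : ∀ i, AEMeasurable (G i) μ)
    (hF₀ : Tendsto (fun i => X.enrm (F i)) l (𝓝 0))
    (hG₀ : Tendsto (fun i => X.enrm (G i)) l (𝓝 0)) :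
    Tendsto (fun i => X.enrm fun x => F i x + G i x) l (𝓝 0) := by
  have hbound := ENNReal.Tendsto.const_mul (a := (X.conc : ℝ≥0∞)) (hF₀.add hG₀)
    (Or.inr ENNReal.coe_ne_top)
  rw [add_zero, mul_zero] at hbound
  exact tendsto_of_tendsto_of_tendsto_of_le_of_le tendsto_const_nhds hbound (fun _ => zero_le)
    fun i => enrm_add_le (hF i) (hG i)

theorem tendsto_enrm_const_mul (a : ℝ≥0) (hF : ∀ i, AEMeasurable (F i) μ)
    (hF₀ : Tendsto (fun i => X.enrm (F i)) l (𝓝 0)) :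
    Tendsto (fun i => X.enrm fun x => a * F i x) l (𝓝 0) := by
  have hmul := ENNReal.Tendsto.const_mul (a := (a : ℝ≥0∞)) hF₀ (Or.inr ENNReal.coe_ne_top)
  rw [mul_zero] at hmul
  exact hmul.congr fun i => (enrm_const_mul a (hF i)).symm

theorem tendsto_enrm_mul_of_tendsto_zero {δ : ι → ℝ≥0} (hδ : Tendsto δ l (𝓝 0))
    (hf : AEMeasurable f μ) (hfin : X.enrm f < ⊤) :
    Tendsto (fun i => X.enrm fun x => δ i * f x) l (𝓝 0) := by
  have hmul := ENNReal.Tendsto.mul_const (ENNReal.tendsto_coe.2 hδ) (Or.inr hfin.ne)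
  rw [ENNReal.coe_zero, zero_mul] at hmul
  exact hmul.congr fun i => (enrm_const_mul (δ i) hf).symm

end Limits

theorem enrm_indicator_top_eq_zero_iff (hf : AEMeasurable f μ) :
    X.enrm ((f ⁻¹' {⊤}).indicator 1) = 0 ↔ ∀ᵐ x ∂μ, f x < ⊤ := by
  rw [enrm_indicator_one_eq_zero_iff (hf.nullMeasurable (measurableSet_singleton ⊤)), ae_iff]
  simp only [not_lt_top_iff]
  rfl

theorem ae_lt_top_of_enrm_lt_top (hf : AEMeasurable f μ) (hfin : X.enrm f < ⊤) :
    ∀ᵐ x ∂μ, f x < ⊤ := by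
  have hind : AEMeasurable ((f ⁻¹' {⊤}).indicator (1 : P → ℝ≥0∞)) μ :=
    aemeasurable_const.indicator₀ (hf.nullMeasurable (measurableSet_singleton ⊤))
  refine (enrm_indicator_top_eq_zero_iff (X := X) hf).1 (by_contra fun hne => ?_)
  obtain ⟨n, hn⟩ := ENNReal.exists_nat_mul_gt hne hfin.ne
  refine hn.not_ge ?_
  calc (n : ℝ≥0∞) * X.enrm ((f ⁻¹' {⊤}).indicator 1)
      = X.enrm (fun x => (n : ℝ≥0) * (f ⁻¹' {⊤}).indicator 1 x) := by
        rw [enrm_const_mul _ hind, ENNReal.coe_natCast]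
    _ ≤ X.enrm f := enrm_mono (hind.const_mul _) hf (Eventually.of_forall fun x => by
        by_cases hx : f x = ⊤ <;> simp [hx])

theorem IsAbsCont.tendsto_enrm_indicator (hX : X.IsAbsCont) (hf : AEMeasurable f μ)
    (hfin : X.enrm f < ⊤) {E : ℕ → Set P} (hE : Antitone E)
    (hEm : ∀ n, NullMeasurableSet (E n) μ) (hE₀ : μ (⋂ n, E n) = 0) :
    Tendsto (fun n => X.enrm ((E n).indicator f)) atTop (𝓝 0) := by
  refine (hX _ ⟨hf.coe_ereal_ennreal, hfin⟩ E hE hEm hE₀).congr fun n => congrArg X.nrm ?_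
  ext x
  by_cases hx : x ∈ E n <;> simp [hx]

theorem IsAbsCont.tendsto_enrm_indicator_natCast_lt (hX : X.IsAbsCont) (hf : AEMeasurable f μ)
    (hfin : X.enrm f < ⊤) (hg : AEMeasurable g μ) (hgtop : ∀ᵐ x ∂μ, g x < ⊤) :
    Tendsto (fun n : ℕ => X.enrm ({x | (n : ℝ≥0∞) < g x}.indicator f)) atTop (𝓝 0) :=
  hX.tendsto_enrm_indicator hf hfin (antitone_setOf_natCast_lt g)
    (fun _ => nullMeasurableSet_lt aemeasurable_const hg) (measure_iInter_setOf_natCast_lt hgtop)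

/-- `‖n χ_{f > n}‖_X → 0`: the weak-type replacement for `f ∈ X`. Only integer levels are used. -/
def HasVanishingTail (X : QBFL μ) (f : P → ℝ≥0∞) : Prop :=
  Tendsto (fun n : ℕ => X.enrm ({x | (n : ℝ≥0∞) < f x}.indicator fun _ => (n : ℝ≥0∞)))
    atTop (𝓝 0)

theorem aemeasurable_indicator_natCast_lt (hf : AEMeasurable f μ) (n : ℕ) :
    AEMeasurable ({x | (n : ℝ≥0∞) < f x}.indicator fun _ => (n : ℝ≥0∞)) μ :=
  aemeasurable_const.indicator₀ (nullMeasurableSet_lt aemeasurable_const hf)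

theorem IsAbsCont.hasVanishingTail (hX : X.IsAbsCont) (hf : AEMeasurable f μ)
    (hfin : X.enrm f < ⊤) : X.HasVanishingTail f :=
  tendsto_enrm_zero_of_le (aemeasurable_indicator_natCast_lt hf)
    (fun _ => hf.indicator₀ (nullMeasurableSet_lt aemeasurable_const hf))
    (hX.tendsto_enrm_indicator_natCast_lt hf hfin hf (ae_lt_top_of_enrm_lt_top hf hfin))
    fun _ => Eventually.of_forall fun x => indicator_le_indicator' fun hx : _ < f x => hx.le

theorem hasVanishingTail_of_tendsto_supLevel
    (h : Tendsto (fun σ : ℝ≥0 => X.nrm ((supLevel (fun x => (f x : EReal)) σ).indicator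
      fun _ => ((σ : ℝ) : EReal))) atTop (𝓝 0)) : X.HasVanishingTail f := by
  refine (h.comp (tendsto_natCast_atTop_atTop (R := ℝ≥0))).congr fun n => congrArg X.nrm ?_
  have hcast : (((n : ℝ≥0) : ℝ) : EReal) = ((n : ℝ≥0∞) : EReal) :=
    (EReal.coe_nnreal_eq_coe_real n).symm
  ext x
  by_cases hx : (n : ℝ≥0∞) < f x <;>
    simp only [supLevel_coe_ennreal, indicator, mem_ofPred_eq, ENNReal.coe_natCast, hx, hcast,
      if_true, if_false, EReal.coe_ennreal_zero]

namespace HasVanishingTail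

theorem congr (h : X.HasVanishingTail f) (hf : AEMeasurable f μ) (hfg : f =ᵐ[μ] g) :
    X.HasVanishingTail g :=
  tendsto_enrm_zero_of_le (aemeasurable_indicator_natCast_lt (hf.congr hfg))
    (aemeasurable_indicator_natCast_lt hf) h fun n => by
      filter_upwards [hfg] with x hx
      simp only [indicator, mem_ofPred_eq, hx, le_refl]

theorem sup (hf : X.HasVanishingTail f) (hg : X.HasVanishingTail g) (hfm : AEMeasurable f μ)
    (hgm : AEMeasurable g μ) : X.HasVanishingTail fun x => max (f x) (g x) := by
  refine tendsto_enrm_zero_of_le (aemeasurable_indicator_natCast_lt (hfm.sup hgm))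
    (fun n => (aemeasurable_indicator_natCast_lt hfm n).add
      (aemeasurable_indicator_natCast_lt hgm n))
    (tendsto_enrm_add (aemeasurable_indicator_natCast_lt hfm)
      (aemeasurable_indicator_natCast_lt hgm) hf hg) fun n => Eventually.of_forall fun x => ?_
  refine indicator_apply_le fun hx : _ < max (f x) (g x) => ?_
  rcases lt_max_iff.1 hx with hx | hx
  · exact le_add_right (indicator_of_mem (s := {x | _ < f x}) hx fun _ => _).ge
  · exact le_add_left (indicator_of_mem (s := {x | _ < g x}) hx fun _ => _).ge

theorem ae_lt_top (h : X.HasVanishingTail f) (hf : AEMeasurable f μ) : ∀ᵐ x ∂μ, f x < ⊤ := by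
  refine (enrm_indicator_top_eq_zero_iff (X := X) hf).1 (le_antisymm (ge_of_tendsto h ?_) zero_le)
  filter_upwards [eventually_ge_atTop 1] with n hn
  refine enrm_mono (aemeasurable_const.indicator₀ (hf.nullMeasurable (measurableSet_singleton ⊤)))
    (aemeasurable_indicator_natCast_lt hf n) (Eventually.of_forall fun x => ?_)
  refine indicator_apply_le fun hx => ?_
  rw [indicator_of_mem (s := {x | _ < f x}) ((ENNReal.natCast_lt_top n).trans_eq (Eq.symm hx))]
  exact Nat.one_le_cast.2 hn

/-- The dominating function is `∑ n_k χ_{f > n_k}` along a sparse sequence of levels; Riesz--Fischer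
puts it in `X`. -/
theorem exists_enrm_lt_top_of_forall_natCast_le (h : X.HasVanishingTail f)
    (hf : AEMeasurable f μ) :
    ∃ F : P → ℝ≥0∞, AEMeasurable F μ ∧ X.enrm F < ⊤ ∧
      ∀ N : ℕ, ∃ n : ℕ, ∀ x, (n : ℝ≥0∞) < f x → (N : ℝ≥0∞) ≤ F x := by
  set T : ℕ → P → ℝ≥0∞ := fun n => {x | (n : ℝ≥0∞) < f x}.indicator fun _ => (n : ℝ≥0∞)
  have hsparse : ∀ k : ℕ, ∃ n ≥ k, (X.conc : ℝ≥0∞) ^ (k + 1) * X.enrm (T n) ≤ 2⁻¹ ^ k := by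
    intro k
    have hmul := ENNReal.Tendsto.const_mul (a := (X.conc : ℝ≥0∞) ^ (k + 1)) h
      (Or.inr (ENNReal.pow_ne_top ENNReal.coe_ne_top))
    rw [mul_zero] at hmul
    have hpos : (0 : ℝ≥0∞) < 2⁻¹ ^ k := ENNReal.pow_pos (by simp) k
    exact ((eventually_ge_atTop k).and (hmul.eventually_le_const hpos)).exists
  choose n hkn hn using hsparse
  refine ⟨fun x => ∑' k, T (n k) x,
    AEMeasurable.tsum fun k => aemeasurable_indicator_natCast_lt hf (n k), ?_,
    fun N => ⟨n N, fun x hx => ?_⟩⟩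
  · calc X.enrm (fun x => ∑' k, T (n k) x)
        ≤ ∑' k, (X.conc : ℝ≥0∞) ^ (k + 1) * X.enrm (T (n k)) :=
          X.riesz_fischer (fun k => T (n k)) fun k => aemeasurable_indicator_natCast_lt hf (n k)
      _ ≤ ∑' k : ℕ, 2⁻¹ ^ k := ENNReal.tsum_le_tsum hn
      _ < ⊤ := by rw [ENNReal.tsum_geometric_two]; exact ENNReal.ofNat_lt_top
  · calc (N : ℝ≥0∞) ≤ n N := Nat.cast_le.2 (hkn N)
      _ = T (n N) x := (indicator_of_mem (s := {x | _ < f x}) hx fun _ => _).symm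
      _ ≤ ∑' k, T (n k) x := ENNReal.le_tsum N

end HasVanishingTail

end QBFL

section NonatomicMeasures

variable {P : Type*} [MeasurableSpace P] {μ : Measure P}

theorem exists_forall_measure_le_of_iUnion_mem {𝒞 : Set (Set P)} (hne : 𝒞.Nonempty)
    (hunion : ∀ T : ℕ → Set P, (∀ n, T n ∈ 𝒞) → ⋃ n, T n ∈ 𝒞) :
    ∃ T ∈ 𝒞, ∀ T' ∈ 𝒞, μ T' ≤ μ T := by
  obtain ⟨m, -, hm, hmem⟩ := exists_seq_tendsto_sSup (hne.image μ) (OrderTop.bddAbove _)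
  choose T hT hTm using hmem
  refine ⟨⋃ n, T n, hunion T hT, fun T' hT' => ?_⟩
  calc μ T' ≤ sSup (μ '' 𝒞) := le_sSup (mem_image_of_mem μ hT')
    _ ≤ μ (⋃ n, T n) := le_of_tendsto' hm fun n => (hTm n).ge.trans (measure_mono <|
        subset_iUnion T n)

namespace IsNonatomic

theorem exists_subset_measure_le_half (hna : IsNonatomic μ) {A : Set P} (hA : MeasurableSet A)
    (hpos : 0 < μ A) : ∃ B ⊆ A, MeasurableSet B ∧ 0 < μ B ∧ μ B ≤ μ A / 2 := by
  obtain ⟨B, hBA, hB, hBpos, hBlt⟩ := hna A hA hpos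
  rcases le_total (μ B) (μ A / 2) with hle | hge
  · exact ⟨B, hBA, hB, hBpos, hle⟩
  · refine ⟨A \ B, sdiff_subset, hA.diff hB, (tsub_pos_iff_lt.2 hBlt).trans_le le_measure_sdiff, ?_⟩
    rw [measure_sdiff_le_iff_le_add hB.nullMeasurableSet hBA hBlt.ne_top]
    calc μ A = μ A / 2 + μ A / 2 := (ENNReal.add_halves _).symm
      _ ≤ μ B + μ A / 2 := by gcongr

theorem exists_subset_measure_le (hna : IsNonatomic μ) {A : Set P} (hA : MeasurableSet A)
    (hpos : 0 < μ A) {ε : ℝ≥0∞} (hε : ε ≠ 0) :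
    ∃ B ⊆ A, MeasurableSet B ∧ 0 < μ B ∧ μ B ≤ ε := by
  obtain ⟨A', hA'A, hA', hA'pos, hA'lt⟩ := hna A hA hpos
  have hhalving : ∀ n : ℕ, ∃ B ⊆ A', MeasurableSet B ∧ 0 < μ B ∧ μ B ≤ μ A' * 2⁻¹ ^ n := by
    intro n
    induction n with
    | zero => exact ⟨A', Subset.rfl, hA', hA'pos, by simp⟩
    | succ n ih =>
      obtain ⟨B, hBA', hB, hBpos, hBle⟩ := ih
      obtain ⟨C, hCB, hC, hCpos, hCle⟩ := hna.exists_subset_measure_le_half hB hBpos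
      refine ⟨C, hCB.trans hBA', hC, hCpos, hCle.trans ?_⟩
      rw [pow_succ, ← mul_assoc, div_eq_mul_inv]
      gcongr
  have hlim : Tendsto (fun n : ℕ => μ A' * 2⁻¹ ^ n) atTop (𝓝 0) := by
    simpa using ENNReal.Tendsto.const_mul
      (ENNReal.tendsto_pow_atTop_nhds_zero_of_lt_one (by simp : (2 : ℝ≥0∞)⁻¹ < 1))
      (Or.inr hA'lt.ne_top)
  obtain ⟨n, hn⟩ := (hlim.eventually_le_const hε.bot_lt).exists
  obtain ⟨B, hBA', hB, hBpos, hBle⟩ := hhalving n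
  exact ⟨B, hBA'.trans hA'A, hB, hBpos, hBle.trans hn⟩

theorem exists_subset_measure_mem_Icc (hna : IsNonatomic μ) {S : Set P}
    (hS : NullMeasurableSet S μ) {c : ℝ≥0∞} (hc : c ≠ 0) (hcS : c ≤ μ S) :
    ∃ T ⊆ S, MeasurableSet T ∧ μ T ∈ Icc c (2 * c) := by
  by_contra! hgap
  set 𝒞 : Set (Set P) := {T | T ⊆ S ∧ MeasurableSet T ∧ μ T ≤ 2 * c}
  have hlt : ∀ T ∈ 𝒞, μ T < c := fun T ⟨hTS, hT, hTc⟩ =>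
    not_le.1 fun h => hgap T hTS hT ⟨h, hTc⟩
  have hsup : ∀ T ∈ 𝒞, ∀ T' ∈ 𝒞, T ∪ T' ∈ 𝒞 := fun T hT T' hT' => by
    refine ⟨union_subset hT.1 hT'.1, hT.2.1.union hT'.2.1, (measure_union_le _ _).trans ?_⟩
    rw [two_mul]
    exact add_le_add (hlt T hT).le (hlt T' hT').le
  have hunion : ∀ T : ℕ → Set P, (∀ n, T n ∈ 𝒞) → ⋃ n, T n ∈ 𝒞 := by
    intro T hT
    have haccumulate : ∀ n, accumulate T n ∈ 𝒞 := by
      intro n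
      induction n with
      | zero => simpa using hT 0
      | succ n ih => simpa only [accumulate_succ] using hsup _ ih _ (hT (n + 1))
    refine ⟨iUnion_subset fun n => (hT n).1, MeasurableSet.iUnion fun n => (hT n).2.1, ?_⟩
    rw [measure_iUnion_eq_iSup_accumulate]
    exact iSup_le fun n => (haccumulate n).2.2
  have hne : 𝒞.Nonempty := ⟨∅, empty_subset S, MeasurableSet.empty, by simp⟩
  obtain ⟨T, hT, hTmax⟩ := exists_forall_measure_le_of_iUnion_mem (μ := μ) hne hunion
  obtain ⟨S', hS'S, hS', hS'ae⟩ := hS.exists_measurable_subset_ae_eq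
  have hrest : 0 < μ (S' \ T) :=
    (tsub_pos_iff_lt.2 ((hlt T hT).trans_le (hcS.trans_eq (measure_congr hS'ae).symm))).trans_le
      le_measure_sdiff
  obtain ⟨B, hBsub, hB, hBpos, hBc⟩ := hna.exists_subset_measure_le (hS'.diff hT.2.1) hrest hc
  have hBmem : B ∈ 𝒞 :=
    ⟨(hBsub.trans sdiff_subset).trans hS'S, hB, hBc.trans (two_mul c ▸ le_self_add)⟩
  have hdisj : Disjoint T B := disjoint_sdiff_right.mono_right hBsub
  refine (hTmax _ (hsup T hT B hBmem)).not_gt ?_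
  rw [measure_union hdisj hB]
  exact ENNReal.lt_add_right (hlt T hT).ne_top hBpos.ne'

theorem exists_measure_lt_top_of_setLIntegral_lt_top (hna : IsNonatomic μ) {f : P → ℝ≥0∞}
    (hf : AEMeasurable f μ)
    (hint : ∀ E, MeasurableSet E → μ E < ⊤ → ∫⁻ x in E, f x ∂μ < ⊤) :
    ∃ σ : ℝ≥0, μ {x | (σ : ℝ≥0∞) < f x} < ⊤ := by
  by_contra! hcon
  have hpieces : ∀ n : ℕ, ∃ T ⊆ {x | ((4 ^ n : ℝ≥0) : ℝ≥0∞) < f x}, MeasurableSet T ∧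
      μ T ∈ Icc (2⁻¹ ^ n) (2 * 2⁻¹ ^ n) := fun n =>
    hna.exists_subset_measure_mem_Icc (nullMeasurableSet_lt aemeasurable_const hf)
      (ENNReal.pow_pos (by simp) n).ne' (le_top.trans (hcon _))
  choose T hTf hT hTm using hpieces
  have hfin : μ (⋃ n, T n) < ⊤ :=
    calc μ (⋃ n, T n) ≤ ∑' n, 2 * 2⁻¹ ^ n :=
          (measure_iUnion_le T).trans (ENNReal.tsum_le_tsum fun n => (hTm n).2)
      _ < ⊤ := by
          rw [ENNReal.tsum_mul_left, ENNReal.tsum_geometric_two]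
          exact ENNReal.mul_lt_top ENNReal.ofNat_lt_top ENNReal.ofNat_lt_top
  have hlower : ∀ n : ℕ, (2 ^ n : ℝ≥0∞) ≤ ∫⁻ x in ⋃ n, T n, f x ∂μ := fun n =>
    calc (2 ^ n : ℝ≥0∞) = 4 ^ n * 2⁻¹ ^ n := by
          rw [← mul_pow, show (4 : ℝ≥0∞) = 2 * 2 by norm_num, mul_assoc,
            ENNReal.mul_inv_cancel two_ne_zero ENNReal.ofNat_ne_top, mul_one]
      _ ≤ 4 ^ n * μ (T n) := by gcongr; exact (hTm n).1
      _ = ∫⁻ _ in T n, 4 ^ n ∂μ := (setLIntegral_const _ _).symm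
      _ ≤ ∫⁻ x in T n, f x ∂μ := setLIntegral_mono' (hT n) fun x hx => by
          have hlt : ((4 ^ n : ℝ≥0) : ℝ≥0∞) < f x := hTf n hx
          exact_mod_cast hlt.le
      _ ≤ _ := lintegral_mono_set (subset_iUnion T n)
  have hpow : Tendsto (fun n : ℕ => (2 ^ n : ℝ≥0∞)) atTop (𝓝 ⊤) :=
    ENNReal.tendsto_pow_atTop_nhds_top_iff.2 ENNReal.one_lt_two
  exact (hint _ (MeasurableSet.iUnion hT) hfin).not_ge (le_of_tendsto' hpow hlower)

theorem exists_measure_supLevel_lt_top (hna : IsNonatomic μ) {q : ℝ} (hq : 0 < q) {f : P → EReal}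
    (hf : MemLqFin μ q f) : ∃ σ : ℝ≥0, μ (supLevel f σ) < ⊤ := by
  obtain ⟨τ, hτ⟩ := hna.exists_measure_lt_top_of_setLIntegral_lt_top
    ((measurable_ereal_abs.comp_aemeasurable hf.1).pow_const q)
    fun E hE => hf.2 E hE.nullMeasurableSet
  refine ⟨τ ^ q⁻¹, (measure_mono fun x (hx : _ < (f x).abs) => ?_).trans_lt hτ⟩
  have hpow := ENNReal.rpow_lt_rpow hx hq
  rwa [← ENNReal.coe_rpow_of_nonneg _ hq.le, NNReal.rpow_inv_rpow hq.ne'] at hpow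

theorem exists_measure_supLevel_lt_top_of_hasVanishingTail (hna : IsNonatomic μ) {X : QBFL μ}
    {q : ℝ} (hq : 0 < q) (hXq : ∀ f : P → EReal, X.Mem f → MemLqFin μ q f) {f : P → ℝ≥0∞}
    (hf : AEMeasurable f μ) (htail : X.HasVanishingTail f) :
    ∃ σ : ℝ≥0, μ (supLevel (fun x => (f x : EReal)) σ) < ⊤ := by
  obtain ⟨F, hF, hFfin, hFf⟩ := htail.exists_enrm_lt_top_of_forall_natCast_le hf
  obtain ⟨τ, hτ⟩ := hna.exists_measure_supLevel_lt_top hq (hXq _ ⟨hF.coe_ereal_ennreal, hFfin⟩)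
  obtain ⟨N, hN⟩ := exists_nat_gt τ
  obtain ⟨n, hn⟩ := hFf N
  refine ⟨n, (measure_mono fun x hx => ?_).trans_lt hτ⟩
  rw [supLevel_coe_ennreal] at hx ⊢
  have hτN : (τ : ℝ≥0∞) < N := by exact_mod_cast hN
  exact hτN.trans_le (hn x (by simpa only [mem_ofPred_eq, ENNReal.coe_natCast] using hx))

end IsNonatomic

end NonatomicMeasures

section LipschitzControl

theorem exists_lipschitzWith_abs_le_eqOn {α : Type*} [PseudoMetricSpace α] {f : α → ℝ} {s : Set α}
    {K : ℝ≥0} (hf : LipschitzOnWith K f s) {C : ℝ≥0} (hC : ∀ x ∈ s, |f x| ≤ C) :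
    ∃ v : α → ℝ, LipschitzWith K v ∧ (∀ x, |v x| ≤ C) ∧ EqOn f v s := by
  obtain ⟨w, hw, hws⟩ := hf.extend_real
  refine ⟨fun x => max (-C) (min (w x) C), (hw.min_const _).const_max _, fun x => ?_,
    fun x hx => ?_⟩
  · exact abs_le.2 ⟨le_max_left _ _,
      max_le ((neg_nonpos.2 C.coe_nonneg).trans C.coe_nonneg) (min_le_right _ _)⟩
  · obtain ⟨hlower, hupper⟩ := abs_le.1 (hC x hx)
    beta_reduce
    rw [← hws hx, min_eq_left hupper, max_eq_right hlower]

/-- A Borel function `k` bounding `|u|` and, off `{k = ∞}`, serving as a Hajłasz gradient of `u`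
without an exceptional null set: that set has been absorbed into `{k = ∞}`. On every sublevel set
`{k ≤ σ}` the function `u` is then bounded and Lipschitz. -/
structure IsLipschitzControl {P : Type*} [PseudoEMetricSpace P] [MeasurableSpace P]
    (k : P → ℝ≥0∞) (u : P → EReal) : Prop where
  measurable : Measurable k
  abs_le : ∀ x, (u x).abs ≤ k x
  abs_sub_le : ∀ x y, k x < ⊤ → k y < ⊤ → (u x - u y).abs ≤ edist x y * (k x + k y)

theorem IsLipschitzControl.exists_lipschitz_extension {P : Type*} [PseudoMetricSpace P]
    [MeasurableSpace P] {k : P → ℝ≥0∞} {u : P → EReal} (hk : IsLipschitzControl k u) (σ : ℝ≥0) :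
    ∃ v : P → ℝ, LipschitzWith (2 * σ) v ∧ (∀ x, |v x| ≤ σ) ∧ ∀ x, k x ≤ σ → u x = v x := by
  have hfin : ∀ {x}, k x ≤ σ → k x < ⊤ := fun hx => hx.trans_lt ENNReal.coe_lt_top
  have hreal : ∀ x, k x ≤ σ → ((u x).toReal : EReal) = u x := fun x hx =>
    ereal_coe_toReal_of_abs_lt_top ((hk.abs_le x).trans_lt (hfin hx))
  have hlip : LipschitzOnWith (2 * σ) (fun x => (u x).toReal) {x | k x ≤ σ} := by
    intro x (hx : k x ≤ σ) y (hy : k y ≤ σ)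
    calc edist (u x).toReal (u y).toReal = (u x - u y).abs := by
          rw [← ereal_abs_coe_sub_coe, hreal x hx, hreal y hy]
      _ ≤ edist x y * (k x + k y) := hk.abs_sub_le x y (hfin hx) (hfin hy)
      _ ≤ edist x y * (σ + σ) := by gcongr
      _ = (2 * σ : ℝ≥0) * edist x y := by
          rw [mul_comm, ← two_mul, ENNReal.coe_mul, ENNReal.coe_ofNat]
  have hbound : ∀ x ∈ {x | k x ≤ σ}, |(u x).toReal| ≤ σ := by
    intro x (hx : k x ≤ σ)
    have habs := (hk.abs_le x).trans hx
    rwa [← hreal x hx, EReal.abs_def, ENNReal.ofReal_le_iff_le_toReal ENNReal.coe_ne_top,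
      ENNReal.coe_toReal] at habs
  obtain ⟨v, hv, hvσ, huv⟩ := exists_lipschitzWith_abs_le_eqOn hlip hbound
  exact ⟨v, hv, hvσ, fun x hx => by rw [← huv (show x ∈ {x | k x ≤ σ} from hx), hreal x hx]⟩

theorem IsHajlaszGradient.exists_isLipschitzControl {P : Type*} [MetricSpace P]
    [MeasurableSpace P] {μ : Measure P} {h : P → ℝ≥0∞} {u : P → EReal}
    (hh : IsHajlaszGradient μ h u) (hu : AEMeasurable u μ) :
    ∃ k, IsLipschitzControl k u ∧ k =ᵐ[μ] fun x => max (h x) (u x).abs := by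
  classical
  obtain ⟨hhm, E, hE, hhaj⟩ := hh
  have hm : AEMeasurable (fun x => max (h x) (u x).abs) μ :=
    hhm.sup (measurable_ereal_abs.comp_aemeasurable hu)
  set m := hm.mk
  have hbad : μ (E ∪ {x | max (h x) (u x).abs ≠ m x}) = 0 :=
    measure_union_null hE (ae_iff.1 hm.ae_eq_mk)
  set N := toMeasurable μ (E ∪ {x | max (h x) (u x).abs ≠ m x})
  have hN₀ : μ N = 0 := by rwa [measure_toMeasurable]
  have hN : ∀ x ∉ N, x ∉ E ∧ max (h x) (u x).abs = m x := fun x hx => by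
    simpa only [mem_union, mem_ofPred_eq, not_or, not_not] using
      notMem_subset (subset_toMeasurable _ _) hx
  set k := N.piecewise (fun _ => ⊤) m
  have hkN : ∀ x ∉ N, k x = max (h x) (u x).abs := fun x hx =>
    (piecewise_eq_of_notMem _ _ _ hx).trans (hN x hx).2.symm
  have hktop : ∀ x ∈ N, k x = ⊤ := fun x hx => piecewise_eq_of_mem _ _ _ hx
  refine ⟨k, ⟨measurable_const.piecewise (measurableSet_toMeasurable _ _) hm.measurable_mk,
    fun x => ?_, fun x y hx hy => ?_⟩, ?_⟩
  · by_cases hxN : x ∈ N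
    · exact le_top.trans_eq (hktop x hxN).symm
    · exact (le_max_right _ _).trans_eq (hkN x hxN).symm
  · have hxN : x ∉ N := fun hxN => hx.ne (hktop x hxN)
    have hyN : y ∉ N := fun hyN => hy.ne (hktop y hyN)
    rw [hkN x hxN, hkN y hyN]
    refine (hhaj x (hN x hxN).1 y (hN y hyN).1).trans ?_
    gcongr <;> exact le_max_left _ _
  · filter_upwards [measure_eq_zero_iff_ae_notMem.1 hN₀] with x hx using hkN x hx

end LipschitzControl

section NewtonianSpace

variable {P : Type*} [MetricSpace P] [MeasurableSpace P] {μ : Measure P} {X : QBFL μ}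
  {u : P → EReal}

theorem exists_isUpperGradient_of_newtonNorm_lt_top (hu : newtonNorm X u < ⊤) :
    ∃ g : P → ℝ≥0∞, IsUpperGradient g u ∧ X.enrm g < ⊤ := by
  have hinf := (ENNReal.add_lt_top.1 hu).2
  simpa only [iInf_lt_iff, exists_prop] using! hinf

theorem newtonNorm_le (hu : AEMeasurable u μ) {g : P → ℝ≥0∞} (hg : IsUpperGradient g u) :
    newtonNorm X u ≤ X.enrm (fun x => (u x).abs) + X.enrm g :=
  add_le_add (QBFL.nrm_eq_enrm_abs hu).le (iInf₂_le g hg)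

theorem enrm_abs_lt_top_of_newtonNorm_lt_top (hu : AEMeasurable u μ) (hfin : newtonNorm X u < ⊤) :
    X.enrm (fun x => (u x).abs) < ⊤ :=
  (QBFL.nrm_eq_enrm_abs hu).ge.trans_lt (ENNReal.add_lt_top.1 hfin).1

theorem newtonNorm_sub_lipschitz_le [OpensMeasurableSpace P] (hu : AEMeasurable u μ)
    {g : P → ℝ≥0∞} (hg : IsUpperGradient g u) {v : P → ℝ} {K C : ℝ≥0} (hv : LipschitzWith K v)
    (hvC : ∀ x, |v x| ≤ C) {A : Set P} (hA : MeasurableSet A) (huv : ∀ x ∉ A, u x = v x)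
    {δ : ℝ≥0} (hδ : δ ≠ 0) :
    newtonNorm X (fun x => u x - v x) ≤
      X.enrm (fun x => A.indicator (fun y => (u y).abs + C) x) +
        X.enrm (fun x => A.indicator (fun y => g y + K) x + δ * g x) := by
  have hw := aemeasurable_ereal_sub_coe hu hv.continuous.measurable.aemeasurable
  have habs := measurable_ereal_abs.comp_aemeasurable hu
  refine (newtonNorm_le hw (hg.sub_lipschitz hv hA huv hδ)).trans (add_le_add_left ?_ _)
  refine QBFL.enrm_mono (measurable_ereal_abs.comp_aemeasurable hw)
    ((habs.add_const _).indicator hA) (Eventually.of_forall fun x => ?_)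
  by_cases hx : x ∈ A
  · rw [indicator_of_mem hx]
    refine (ereal_abs_sub_coe_le (u x) (v x)).trans (add_le_add_right ?_ _)
    rw [EReal.abs_def]
    exact ENNReal.ofReal_le_of_le_toReal (hvC x)
  · rw [indicator_of_notMem hx, huv x hx, ereal_abs_coe_sub_coe, edist_self]

namespace MemNewton

theorem of_sub (hu : MemNewton X u) {v : P → ℝ} (hv : AEMeasurable v μ)
    (huv : newtonNorm X (fun x => u x - v x) < ⊤) : MemNewton X (fun x => (v x : EReal)) := by
  have hw := aemeasurable_ereal_sub_coe hu.1 hv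
  obtain ⟨g, hg, hgfin⟩ := exists_isUpperGradient_of_newtonNorm_lt_top hu.2
  obtain ⟨G, hG, hGfin⟩ := exists_isUpperGradient_of_newtonNorm_lt_top huv
  have hua := measurable_ereal_abs.comp_aemeasurable hu.1
  have hwa := measurable_ereal_abs.comp_aemeasurable hw
  have hva := measurable_ereal_abs.comp_aemeasurable hv.coe_real_ereal
  refine ⟨hv.coe_real_ereal, (newtonNorm_le hv.coe_real_ereal (hg.of_sub hG)).trans_lt
    (ENNReal.add_lt_top.2 ⟨?_, ?_⟩)⟩
  · calc X.enrm (fun x => (v x : EReal).abs)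
        ≤ X.enrm (fun x => (u x).abs + (u x - v x).abs) :=
          QBFL.enrm_mono hva (hua.add hwa) <| Eventually.of_forall fun x =>
            ereal_abs_coe_le_abs_add_abs_sub (u x) (v x)
      _ < ⊤ := QBFL.enrm_add_lt_top hua hwa (enrm_abs_lt_top_of_newtonNorm_lt_top hu.1 hu.2)
          (enrm_abs_lt_top_of_newtonNorm_lt_top hw huv)
  · exact QBFL.enrm_add_lt_top hg.1.aemeasurable hG.1.aemeasurable hgfin hGfin

theorem exists_lipschitz_tendsto_newtonNorm [OpensMeasurableSpace P] (hX : X.IsAbsCont)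
    (hu : MemNewton X u) {k : P → ℝ≥0∞} (hk : IsLipschitzControl k u)
    (htail : X.HasVanishingTail k) :
    ∃ v : ℕ → P → ℝ, (∀ n, ∃ K, LipschitzWith K (v n)) ∧
      (∀ n : ℕ, ∀ x, k x ≤ n → u x = v n x) ∧
      Tendsto (fun n => newtonNorm X (fun x => u x - v n x)) atTop (𝓝 0) := by
  choose v hv hvC huv using fun n : ℕ => hk.exists_lipschitz_extension n
  obtain ⟨g, hg, hgfin⟩ := exists_isUpperGradient_of_newtonNorm_lt_top hu.2
  have hua := measurable_ereal_abs.comp_aemeasurable hu.1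
  have hgm : AEMeasurable g μ := hg.1.aemeasurable
  have hkm : AEMeasurable k μ := hk.measurable.aemeasurable
  set A : ℕ → Set P := fun n => {x | (n : ℝ≥0∞) < k x}
  have hA : ∀ n, MeasurableSet (A n) := fun n => measurableSet_lt measurable_const hk.measurable
  set T : ℕ → P → ℝ≥0∞ := fun n => (A n).indicator fun _ => (n : ℝ≥0∞)
  have hT : ∀ n, AEMeasurable (T n) μ := QBFL.aemeasurable_indicator_natCast_lt hkm
  have hktop : ∀ᵐ x ∂μ, k x < ⊤ := htail.ae_lt_top hkm
  have hδ : Tendsto (fun n : ℕ => ((n : ℝ≥0) + 1)⁻¹) atTop (𝓝 0) := by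
    simpa only [one_div] using tendsto_one_div_add_atTop_nhds_zero_nat (𝕜 := ℝ≥0)
  have hfun : Tendsto (fun n => X.enrm fun x => (A n).indicator (fun y => (u y).abs) x + T n x)
      atTop (𝓝 0) :=
    QBFL.tendsto_enrm_add (fun n => hua.indicator (hA n)) hT
      (hX.tendsto_enrm_indicator_natCast_lt hua
        (enrm_abs_lt_top_of_newtonNorm_lt_top hu.1 hu.2) hkm hktop) htail
  have hgrad : Tendsto (fun n : ℕ => X.enrm fun x => ((A n).indicator g x + (2 : ℝ≥0) * T n x) +
      (((n : ℝ≥0) + 1)⁻¹ : ℝ≥0) * g x) atTop (𝓝 0) :=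
    QBFL.tendsto_enrm_add (fun n => (hgm.indicator (hA n)).add ((hT n).const_mul _))
      (fun n => hgm.const_mul _)
      (QBFL.tendsto_enrm_add (fun n => hgm.indicator (hA n)) (fun n => (hT n).const_mul _)
        (hX.tendsto_enrm_indicator_natCast_lt hgm hgfin hkm hktop)
        (QBFL.tendsto_enrm_const_mul 2 hT htail))
      (QBFL.tendsto_enrm_mul_of_tendsto_zero hδ hgm hgfin)
  have hsum := hfun.add hgrad
  rw [add_zero] at hsum
  refine ⟨v, fun n => ⟨_, hv n⟩, huv, ?_⟩
  refine tendsto_of_tendsto_of_tendsto_of_le_of_le tendsto_const_nhds hsum (fun _ => zero_le)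
    fun n => (newtonNorm_sub_lipschitz_le hu.1 hg (hv n) (hvC n) (hA n)
      (fun x hx => huv n x (not_lt.1 hx)) (δ := ((n : ℝ≥0) + 1)⁻¹) (by positivity)).trans_eq ?_
  congr 2 with x
  · by_cases hx : x ∈ A n <;> simp [T, hx]
  · by_cases hx : x ∈ A n <;> simp [T, hx]

end MemNewton

end NewtonianSpace
section Approximation

theorem exists_nat_choice_of_eventually {p : ℝ → ℕ → Prop}
    (hp : ∀ ε, 0 < ε → ∀ᶠ n in atTop, p ε n) :
    ∃ n : ℝ → ℕ, (∀ ε, 0 < ε → p ε (n ε)) ∧ ∀ m, ∃ ε, 0 < ε ∧ m ≤ n ε := by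
  have hchoice : ∀ ε : ℝ, ∃ n : ℕ, 0 < ε → p ε n ∧ ⌈ε⁻¹⌉₊ ≤ n := fun ε => by
    by_cases hε : 0 < ε
    · exact (((hp ε hε).and (eventually_ge_atTop _)).exists).imp fun n hn _ => hn
    · exact ⟨0, fun hε' => absurd hε' hε⟩
  choose n hn using hchoice
  refine ⟨n, fun ε hε => (hn ε hε).1, fun m => ⟨((m : ℝ) + 1)⁻¹, by positivity, ?_⟩⟩
  have hceil := (hn ((m : ℝ) + 1)⁻¹ (by positivity)).2
  rw [inv_inv, Nat.ceil_le] at hceil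
  exact_mod_cast (lt_add_one (m : ℝ)).le.trans hceil

variable {P : Type*} [MeasurableSpace P] {μ : Measure P}

theorem tendsto_measure_setOf_natCast_lt {f : P → ℝ≥0∞} (hf : AEMeasurable f μ)
    (hftop : ∀ᵐ x ∂μ, f x < ⊤) {σ : ℝ≥0} (hσ : μ {x | (σ : ℝ≥0∞) < f x} < ⊤) :
    Tendsto (fun n : ℕ => μ {x | (n : ℝ≥0∞) < f x}) atTop (𝓝 0) := by
  obtain ⟨m, hm⟩ := exists_nat_gt σ
  have hσm : (σ : ℝ≥0∞) < m := by exact_mod_cast hm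
  rw [← measure_iInter_setOf_natCast_lt hftop]
  exact tendsto_measure_iInter_atTop (fun n => nullMeasurableSet_lt aemeasurable_const hf)
    (antitone_setOf_natCast_lt f)
    ⟨m, ((measure_mono fun x (hx : _ < f x) => hσm.trans hx).trans_lt hσ).ne⟩

theorem exists_measure_max_gt_lt_top {f g : P → ℝ≥0∞} {σ τ : ℝ≥0}
    (hf : μ {x | (σ : ℝ≥0∞) < f x} < ⊤) (hg : μ {x | (τ : ℝ≥0∞) < g x} < ⊤) :
    ∃ ρ : ℝ≥0, μ {x | (ρ : ℝ≥0∞) < max (f x) (g x)} < ⊤ := by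
  refine ⟨max σ τ, (measure_mono fun x (hx : _ < max (f x) (g x)) => ?_).trans_lt
    ((measure_union_le _ _).trans_lt (ENNReal.add_lt_top.2 ⟨hf, hg⟩))⟩
  exact (lt_max_iff.1 hx).imp (ENNReal.coe_le_coe.2 (le_max_left σ τ)).trans_lt
    (ENNReal.coe_le_coe.2 (le_max_right σ τ)).trans_lt

/-- The Lipschitz function `v` approximates `u` up to `ε` in the Newtonian quasi-norm, and `E` is a
measurable set outside which `v` equals `u`. -/
def IsLipschitzApproximation [MetricSpace P] (X : QBFL μ) (u : P → EReal) (ε : ℝ) (v : P → ℝ)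
    (E : Set P) : Prop :=
  (∃ K : ℝ≥0, LipschitzWith K v) ∧ MemNewton X (fun x => (v x : EReal)) ∧
    newtonNorm X (fun x => u x - v x) < ENNReal.ofReal ε ∧ NullMeasurableSet E μ ∧
    ∀ x ∉ E, u x = v x

theorem MemNewton.exists_isLipschitzApproximation [MetricSpace P] [OpensMeasurableSpace P]
    {X : QBFL μ} (hX : X.IsAbsCont) {u : P → EReal} (hu : MemNewton X u) {k : P → ℝ≥0∞}
    (hk : IsLipschitzControl k u) (htail : X.HasVanishingTail k) :
    ∃ (v : ℝ → P → ℝ) (E : ℝ → Set P),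
      (∀ ε : ℝ, 0 < ε → IsLipschitzApproximation X u ε (v ε) (E ε)) ∧
      μ (⋂ ε ∈ Ioi (0 : ℝ), E ε) = 0 ∧
      ((∃ σ : ℝ≥0, μ {x | (σ : ℝ≥0∞) < k x} < ⊤) →
        ∀ ε : ℝ, 0 < ε → μ (E ε) < ENNReal.ofReal ε) := by
  have hkm : AEMeasurable k μ := hk.measurable.aemeasurable
  have hktop := htail.ae_lt_top hkm
  obtain ⟨v, hvlip, huv, hvlim⟩ := hu.exists_lipschitz_tendsto_newtonNorm hX hk htail
  obtain ⟨n, hn, hn_unbounded⟩ := exists_nat_choice_of_eventually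
    (p := fun ε n => newtonNorm X (fun x => u x - v n x) < ENNReal.ofReal ε ∧
      ((∃ σ : ℝ≥0, μ {x | (σ : ℝ≥0∞) < k x} < ⊤) →
        μ {x | (n : ℝ≥0∞) < k x} < ENNReal.ofReal ε)) fun ε hε =>
    (hvlim.eventually_lt_const (ENNReal.ofReal_pos.2 hε)).and <|
      eventually_imp_distrib_left.2 fun ⟨_, hσ⟩ =>
        (tendsto_measure_setOf_natCast_lt hkm hktop hσ).eventually_lt_const
          (ENNReal.ofReal_pos.2 hε)
  refine ⟨fun ε => v (n ε), fun ε => {x | (n ε : ℝ≥0∞) < k x}, fun ε hε =>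
    ⟨hvlip _, ?_, (hn ε hε).1, nullMeasurableSet_lt aemeasurable_const hkm,
      fun x hx => huv _ x (not_lt.1 hx)⟩, ?_, fun hfin ε hε => (hn ε hε).2 hfin⟩
  · obtain ⟨K, hK⟩ := hvlip (n ε)
    exact hu.of_sub hK.continuous.measurable.aemeasurable
      ((hn ε hε).1.trans ENNReal.ofReal_lt_top)
  · refine measure_mono_null (fun x hx => mem_iInter.2 fun m => ?_)
      (measure_iInter_setOf_natCast_lt hktop)
    obtain ⟨ε, hε, hmn⟩ := hn_unbounded m
    exact antitone_setOf_natCast_lt k hmn (mem_iInter₂.1 hx ε hε)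

end Approximation

theorem exists_measure_supLevel_lt_top_of_integrability {P : Type*} [MeasurableSpace P]
    {μ : Measure P} {X : QBFL μ} {u : P → EReal} (hu : X.Mem u) {h : P → ℝ≥0∞}
    (hh : AEMeasurable h μ) (htail : X.HasVanishingTail h)
    (hcase : (∃ σ : ℝ≥0, μ (supLevel (fun x => (h x : EReal)) σ) < ⊤ ∧ μ (supLevel u σ) < ⊤) ∨
      IsNonatomic μ ∧ ((∃ q : ℝ, 0 < q ∧ MemLqFin μ q u ∧ MemLqFin μ q (fun x => (h x : EReal))) ∨
        (∃ q : ℝ, 0 < q ∧ ∀ f : P → EReal, X.Mem f → MemLqFin μ q f))) :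
    (∃ σ : ℝ≥0, μ (supLevel (fun x => (h x : EReal)) σ) < ⊤) ∧
      ∃ σ : ℝ≥0, μ (supLevel u σ) < ⊤ := by
  rcases hcase with ⟨σ, hhσ, huσ⟩ | ⟨hna, ⟨q, hq, huq, hhq⟩ | ⟨q, hq, hXq⟩⟩
  · exact ⟨⟨σ, hhσ⟩, σ, huσ⟩
  · exact ⟨hna.exists_measure_supLevel_lt_top hq hhq, hna.exists_measure_supLevel_lt_top hq huq⟩
  · exact ⟨hna.exists_measure_supLevel_lt_top_of_hasVanishingTail hq hXq hh htail,
      hna.exists_measure_supLevel_lt_top hq (hXq u hu)⟩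

theorem mainTheorem6_general {P : Type*} [MetricSpace P] [MeasurableSpace P]
    [OpensMeasurableSpace P] (μ : Measure P) (X : QBFL μ) (hX : X.IsAbsCont)
    (u : P → EReal) (hu : MemNewton X u)
    (h : P → ℝ≥0∞) (hh : IsHajlaszGradient μ h u)
    (hweak :
      Tendsto (fun σ : ℝ≥0 =>
        X.nrm ((supLevel (fun x => (h x : EReal)) σ).indicator (fun _ => ((σ : ℝ) : EReal))))
        atTop (𝓝 0) ∨
      X.Mem (fun x => (h x : EReal))) :
    ∃ (v : ℝ → P → ℝ) (E : ℝ → Set P),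
      (∀ ε : ℝ, 0 < ε → IsLipschitzApproximation X u ε (v ε) (E ε)) ∧
      μ (⋂ ε ∈ Ioi (0 : ℝ), E ε) = 0 ∧
      ((∃ σ : ℝ≥0, μ (supLevel (fun x => (h x : EReal)) σ) < ⊤ ∧ μ (supLevel u σ) < ⊤) ∨
          IsNonatomic μ ∧
            ((∃ q : ℝ, 0 < q ∧ MemLqFin μ q u ∧ MemLqFin μ q (fun x => (h x : EReal))) ∨
              (∃ q : ℝ, 0 < q ∧ ∀ f : P → EReal, X.Mem f → MemLqFin μ q f)) →
        ∀ ε : ℝ, 0 < ε → μ (E ε) < ENNReal.ofReal ε) := by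
  have huX : X.enrm (fun x => (u x).abs) < ⊤ := enrm_abs_lt_top_of_newtonNorm_lt_top hu.1 hu.2
  have huabs := measurable_ereal_abs.comp_aemeasurable hu.1
  have hhtail : X.HasVanishingTail h := hweak.elim QBFL.hasVanishingTail_of_tendsto_supLevel
    fun hhX => hX.hasVanishingTail hh.1 hhX.2
  obtain ⟨k, hk, hkae⟩ := hh.exists_isLipschitzControl hu.1
  have hktail : X.HasVanishingTail k :=
    (hhtail.sup (hX.hasVanishingTail huabs huX) hh.1 huabs).congr (hh.1.sup huabs) hkae.symm
  obtain ⟨v, E, happrox, hnull, hsmall⟩ := hu.exists_isLipschitzApproximation hX hk hktail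
  refine ⟨v, E, happrox, hnull, fun hcase => hsmall ?_⟩
  obtain ⟨⟨σ, hσ⟩, τ, hτ⟩ := exists_measure_supLevel_lt_top_of_integrability
    ⟨hu.1, (ENNReal.add_lt_top.1 hu.2).1⟩ hh.1 hhtail hcase
  rw [supLevel_coe_ennreal] at hσ
  obtain ⟨ρ, hρ⟩ := exists_measure_max_gt_lt_top hσ hτ
  exact ⟨ρ, (measure_mono_ae (hkae.mono fun x hx (hxρ : _ < k x) => hxρ.trans_eq hx)).trans_lt hρ⟩

theorem mainTheorem6 {P : Type*} [MetricSpace P] [MeasurableSpace P] [BorelSpace P]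
    (μ : Measure P) [SigmaFinite μ] (hna : IsNonatomic μ)
    (hball : ∀ (x : P) (r : ℝ), 0 < r → 0 < μ (Metric.ball x r) ∧ μ (Metric.ball x r) < ⊤)
    (X : QBFL μ) (hX : X.IsAbsCont)
    (u : P → EReal) (hu : MemNewton X u)
    (h : P → ℝ≥0∞) (hh : IsHajlaszGradient μ h u)
    (hweak :
      Tendsto (fun σ : ℝ≥0 =>
        X.nrm ((supLevel (fun x => (h x : EReal)) σ).indicator (fun _ => ((σ : ℝ) : EReal))))
        atTop (𝓝 0) ∨
      X.Mem (fun x => (h x : EReal))) :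
    ∃ (v : ℝ → P → ℝ) (E : ℝ → Set P),
      (∀ ε : ℝ, 0 < ε →
        (∃ K : ℝ≥0, LipschitzWith K (v ε)) ∧
        MemNewton X (fun x => (v ε x : EReal)) ∧
        newtonNorm X (fun x => u x - (v ε x : EReal)) < ENNReal.ofReal ε ∧
        NullMeasurableSet (E ε) μ ∧
        ∀ x ∉ E ε, u x = (v ε x : EReal)) ∧
      μ (⋂ ε ∈ Ioi (0 : ℝ), E ε) = 0 ∧
      (((∃ σ : ℝ≥0, 0 < σ ∧ μ (supLevel (fun x => (h x : EReal)) σ) < ⊤ ∧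
            μ (supLevel u σ) < ⊤) ∨
          (∃ q : ℝ, 0 < q ∧ MemLqFin μ q u ∧ MemLqFin μ q (fun x => (h x : EReal))) ∨
          (∃ q : ℝ, 0 < q ∧ ∀ f : P → EReal, X.Mem f → MemLqFin μ q f)) →
        ∀ ε : ℝ, 0 < ε → μ (E ε) < ENNReal.ofReal ε) := by
  obtain ⟨v, E, happrox, hnull, hsmall⟩ := mainTheorem6_general μ X hX u hu h hh hweak
  exact ⟨v, E, happrox, hnull, fun hcase =>
    hsmall (hcase.imp (fun ⟨σ, _, hσ⟩ => ⟨σ, hσ⟩) (⟨hna, ·⟩))⟩
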